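/- Let $k\ge 2$ be an integer and let $F$ be a finite simple graph with chromatic number $\chi(F)=k+1$. A graph is called $F$-free if it has no (not necessarily induced) subgraph isomorphic to $F$; $d(v)$ denotes the degree of $v$. Then there is a sequence of real numbers $(\varepsilon_n)_{n\ge 0}$, depending only on $F$, with $\varepsilon_n\to 0$ as $n\to\infty$, such that every finite simple $F$-free graph $G$ with $n$ vertices and $m$ edges satisfies $$\sum_{v\in V(G)} d(v)^2\le 2\Bigl(1-\frac1k+\varepsilon_n\Bigr)mn .$$ Moreover, the bound is tight in the following sense. If $k=2$, then every complete bipartite graph $G=K_{a,b}$ is $F$-free and, with $n=a+b$ vertices and $m=ab$ edges, satisfies $\sum_{v\in V(G)} d(v)^2= 2\left(1-\frac1k\right)mn=mn$. If $k\ge 3$, let $T_{n,k}$ be the $k$-partite Turán graph, i.e. the complete $k$-partite graph on $n$ vertices whose part sizes are as equal as possible. Then $T_{n,k}$ is $F$-free for every $n$, and there is a sequence of real numbers $\delta_n\to 0$ such that for every $n$ $$\sum_{v\in V(T_{n,k})} d(v)^2= 2\Bigl(1-\frac1k+\delta_n\Bigr)\,e(T_{n,k})\,n ,$$ where $e(T_{n,k})$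 is the number of edges of $T_{n,k}$. -/

import Mathlib

open Filter Topology

/-! Write `E = ∑ d(v) = 2m` and `P = ∑ d(v) ^ 2`; the bound to reach is `P ≤ (1 - 1/k + o(1)) n E`.
Without `(k + 1)`-cliques it holds with no error term: the weighted form in
`CliqueFree.sum_weight_mul_degree_sq_le` follows by moving weight between non-adjacent vertices, as
in Motzkin–Straus, until the support is a clique. An `F`-free graph may contain `(k + 1)`-cliques,
but only `o(n ^ (k + 1))` of them, since `F` lies in a blow-up of such a clique
(`Colorable.exists_forall_cliqueHomCount_le`). Averaging the clique-free bound over random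
`s`-tuples of vertices carries it over to `G` with an additive error `o(n ^ 3)`. That error is
harmless only if `E` has order `n ^ 2`. For smaller `E`, `two_mul_sum_degree_sq_le` gives `P ≤ (1/2
+ o(1)) n E` for every graph, which suffices because `k ≥ 2`. For tightness, complete bipartite
graphs are computed exactly, and Turán graphs are almost regular. -/

/-! ### The weighted inequality for clique-free graphs. -/

theorem sum_mul_sub_mul_sub_le {ι : Type*} (T : Finset ι) (w : ι → ℝ) (hw : ∀ i, 0 ≤ w i) {k : ℕ}
    (hT : T.card ≤ k) (hk : 1 ≤ k) :
    ∑ i ∈ T, w i * ((∑ j ∈ T, w j) - w i) ^ 2 ≤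
      (1 - 1 / (k : ℝ)) * (∑ j ∈ T, w j) * ∑ i ∈ T, w i * ((∑ j ∈ T, w j) - w i) := by
  set S := ∑ j ∈ T, w j with hS
  have hle : ∀ i ∈ T, w i ≤ S := fun i hi =>
    Finset.single_le_sum (f := w) (fun j _ => hw j) hi
  have hS0 : 0 ≤ S := Finset.sum_nonneg fun j _ => hw j
  have hk0 : (0 : ℝ) < k := by exact_mod_cast hk
  have hswap : ∑ i ∈ T, ∑ j ∈ T, w i * (S - w i) * (w j - w i) =
      ∑ i ∈ T, ∑ j ∈ T, w j * (S - w j) * (w i - w j) := Finset.sum_comm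
  -- Chebyshev-style symmetrization: adding the `(i, j)` and `(j, i)` terms gives `-(w i - w j) ^ 2
  -- * (S - w i - w j)`.
  have hpair : 2 * ∑ i ∈ T, ∑ j ∈ T, w i * (S - w i) * (w j - w i) ≤ 0 := by
    rw [two_mul]
    nth_rewrite 2 [hswap]
    simp only [← Finset.sum_add_distrib]
    refine Finset.sum_nonpos fun i hi => Finset.sum_nonpos fun j hj => ?_
    by_cases hij : i = j
    · subst hij; simp
    have h2 : w i + w j ≤ S := by
      classical
      rw [← Finset.sum_pair (f := w) hij]
      refine Finset.sum_le_sum_of_subset_of_nonneg (f := w) (fun x hx => ?_) fun x _ _ => hw x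
      rcases Finset.mem_insert.1 hx with rfl | hx
      · exact hi
      · rwa [Finset.mem_singleton.1 hx]
    nlinarith [mul_nonneg (sub_nonneg.2 h2) (sq_nonneg (w i - w j))]
  have hinner : ∀ i, ∑ j ∈ T, w i * (S - w i) * (w j - w i) =
      w i * (S - w i) * (S - T.card * w i) := by
    intro i
    rw [← Finset.mul_sum, Finset.sum_sub_distrib, Finset.sum_const, nsmul_eq_mul]
  simp only [hinner] at hpair
  have hmono : ∑ i ∈ T, w i * (S - w i) * (S - k * w i) ≤
      ∑ i ∈ T, w i * (S - w i) * (S - T.card * w i) := by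
    refine Finset.sum_le_sum fun i hi => ?_
    refine mul_le_mul_of_nonneg_left ?_ (mul_nonneg (hw i) (sub_nonneg.2 (hle i hi)))
    have : (T.card : ℝ) ≤ k := by exact_mod_cast hT
    nlinarith [hw i]
  have hid : ∑ i ∈ T, w i * (S - w i) ^ 2 - (1 - 1 / (k : ℝ)) * S * ∑ i ∈ T, w i * (S - w i) =
      (1 / k) * ∑ i ∈ T, w i * (S - w i) * (S - k * w i) := by
    clear_value S
    rw [Finset.mul_sum, Finset.mul_sum, ← Finset.sum_sub_distrib]
    refine Finset.sum_congr rfl fun i _ => ?_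
    field_simp
    ring
  have : (1 / (k : ℝ)) * ∑ i ∈ T, w i * (S - w i) * (S - k * w i) ≤ 0 :=
    mul_nonpos_of_nonneg_of_nonpos (by positivity) (by linarith)
  linarith

namespace SimpleGraph

open Matrix

/-- A weighted form, for graphs without a `(k + 1)`-clique, of the bound
`∑ d(v) ^ 2 ≤ 2 (1 - 1 / k) m n`. -/
theorem CliqueFree.sum_weight_mul_degree_sq_le {V : Type*} [Fintype V] [DecidableEq V]
    {G : SimpleGraph V} [DecidableRel G.Adj] {k : ℕ} (hk : 1 ≤ k) (hG : G.CliqueFree (k + 1))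
    (w : V → ℝ) (hw : ∀ x, 0 ≤ w x) :
    ∑ x, w x * (G.adjMatrix ℝ *ᵥ w) x ^ 2 ≤
      (1 - 1 / (k : ℝ)) * (∑ x, w x) * ∑ x, w x * (G.adjMatrix ℝ *ᵥ w) x := by
  induction hN : (Finset.univ.filter fun x => w x ≠ 0).card using Nat.strong_induction_on
    generalizing w with
  | _ N ih =>
  set T := Finset.univ.filter fun x => w x ≠ 0 with hTdef
  have hT : ∀ x, x ∉ T → w x = 0 := fun x hx => by simpa [hTdef] using hx
  -- If the support is a clique, each weighted degree on it is the total weight minus the vertex's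
  -- own weight.
  by_cases hcl : G.IsClique T
  · have hcard : T.card ≤ k := by
      by_contra! h
      exact (hG.mono h) T ⟨hcl, rfl⟩
    have hsum : ∀ f : V → ℝ, ∑ x, w x * f x = ∑ x ∈ T, w x * f x := fun f =>
      (Finset.sum_subset (Finset.subset_univ T) fun x _ hx => by rw [hT x hx, zero_mul]).symm
    have hS : ∑ x, w x = ∑ x ∈ T, w x := by simpa using hsum fun _ => 1
    have hD : ∀ x ∈ T, (G.adjMatrix ℝ *ᵥ w) x = (∑ y ∈ T, w y) - w x := by
      intro x hx
      rw [← Finset.sum_erase_eq_sub hx, mulVec, dotProduct]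
      rw [← Finset.sum_subset (Finset.subset_univ (T.erase x))]
      · refine Finset.sum_congr rfl fun y hy => ?_
        rw [Finset.mem_erase] at hy
        rw [adjMatrix_apply, if_pos (hcl hx hy.2 hy.1.symm), one_mul]
      · intro y _ hy
        by_cases hyx : y = x
        · simp [hyx]
        · rw [hT y fun h => hy (Finset.mem_erase.2 ⟨hyx, h⟩), mul_zero]
    have e1 := hsum fun x => (G.adjMatrix ℝ *ᵥ w) x ^ 2
    have e2 := hsum fun x => (G.adjMatrix ℝ *ᵥ w) x
    rw [e1, e2, hS, Finset.sum_congr rfl fun x hx => by rw [hD x hx],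
      Finset.sum_congr (f := fun x => w x * (G.adjMatrix ℝ *ᵥ w) x) rfl
        fun x hx => by rw [hD x hx]]
    exact sum_mul_sub_mul_sub_le T w hw hcard hk
  · obtain ⟨u, hu, v, hv, huv, hadj⟩ : ∃ u ∈ T, ∃ v ∈ T, u ≠ v ∧ ¬ G.Adj u v := by
      simpa [IsClique, Set.Pairwise] using hcl
    -- Direction moving weight from `v` to `u`. Non-adjacency makes `z * E` vanish pointwise, so
    -- along `w + s z` the left side minus the right side is quadratic in `s`, with leading
    -- coefficient `α ≥ 0`.
    set z : V → ℝ := Pi.single u 1 - Pi.single v 1 with hz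
    have hzsum : ∑ x, z x = 0 := by simp [hz]
    have hzE : ∀ x, z x * (G.adjMatrix ℝ *ᵥ z) x = 0 := by
      intro x
      by_cases hxu : x = u
      · subst hxu; simp [hz, hadj]
      by_cases hxv : x = v
      · subst hxv; simp [hz, hadj, G.adj_comm]
      simp [hz, hxu, hxv]
    set c : ℝ := 1 - 1 / (k : ℝ)
    set S := ∑ x, w x with hS
    set D := G.adjMatrix ℝ *ᵥ w with hD
    set E := G.adjMatrix ℝ *ᵥ z with hE
    set α := ∑ x, w x * E x ^ 2
    set β := ∑ x, (2 * w x * D x * E x + z x * D x ^ 2) - c * S * ∑ x, (w x * E x + z x * D x)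
    have hα : 0 ≤ α := Finset.sum_nonneg fun x _ => mul_nonneg (hw x) (sq_nonneg _)
    have key : ∀ s : ℝ, ∑ x, (w x + s * z x) * (D x + s * E x) ^ 2 -
        c * S * ∑ x, (w x + s * z x) * (D x + s * E x) =
        (∑ x, w x * D x ^ 2 - c * S * ∑ x, w x * D x) + s * β + s ^ 2 * α := by
      intro s
      simp only [α, β, Finset.mul_sum, mul_sub, ← Finset.sum_add_distrib, ← Finset.sum_sub_distrib]
      refine Finset.sum_congr rfl fun x _ => ?_
      linear_combination (2 * s ^ 2 * D x + s ^ 3 * E x - c * S * s ^ 2) * hzE x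
    -- If `s * β ≥ 0`, the move does not decrease this difference, so the induction hypothesis on
    -- the smaller support bounds the original one. The sign of `β` decides whether `v` or `u` is
    -- emptied.
    have step : ∀ s : ℝ, (∀ x, 0 ≤ w x + s * z x) → (∃ y ∈ T, w y + s * z y = 0) → 0 ≤ s * β →
        ∑ x, w x * D x ^ 2 ≤ c * S * ∑ x, w x * D x := by
      intro s hs ⟨y, hyT, hy⟩ hβ
      have hlt : (Finset.univ.filter fun x => w x + s * z x ≠ 0).card < N := by
        rw [← hN]
        refine Finset.card_lt_card (Finset.ssubset_iff_of_subset ?_ |>.2 ⟨y, hyT, by simp [hy]⟩)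
        intro x hx
        by_contra hxT
        have hxu : x ≠ u := fun h => hxT (h ▸ hu)
        have hxv : x ≠ v := fun h => hxT (h ▸ hv)
        simp [hz, hxu, hxv, hT x hxT] at hx
      have h1 := ih _ hlt (fun x => w x + s * z x) hs rfl
      have h2 : (G.adjMatrix ℝ *ᵥ fun x => w x + s * z x) = fun x => D x + s * E x := by
        have : (fun x => w x + s * z x) = w + s • z := by ext; simp
        rw [this, mulVec_add, mulVec_smul]
        ext; simp [hD, hE]
      have h3 : ∑ x, (w x + s * z x) = S := by
        rw [Finset.sum_add_distrib, ← Finset.mul_sum, hzsum, mul_zero, add_zero]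
      rw [h2, h3] at h1
      have := key s
      nlinarith [mul_nonneg (sq_nonneg s) hα]
    have hzu : z u = 1 := by simp [hz, huv]
    have hzv : z v = -1 := by simp [hz, huv.symm]
    have hzx : ∀ x, x ≠ u → x ≠ v → z x = 0 := fun x h1 h2 => by simp [hz, h1, h2]
    rcases le_total 0 β with hβ | hβ
    · refine step (w v) (fun x => ?_) ⟨v, hv, by rw [hzv]; ring⟩ (mul_nonneg (hw v) hβ)
      by_cases hxu : x = u
      · subst hxu; rw [hzu]; linarith [hw x, hw v]
      by_cases hxv : x = v
      · subst hxv; rw [hzv]; linarith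
      rw [hzx x hxu hxv]; linarith [hw x]
    · refine step (-w u) (fun x => ?_) ⟨u, hu, by rw [hzu]; ring⟩ (by nlinarith [hw u])
      by_cases hxu : x = u
      · subst hxu; rw [hzu]; linarith
      by_cases hxv : x = v
      · subst hxv; rw [hzv]; linarith [hw x, hw u]
      rw [hzx x hxu hxv]; linarith [hw x]

theorem CliqueFree.sum_degree_sq_le {V : Type*} [Fintype V] [DecidableEq V]
    {G : SimpleGraph V} [DecidableRel G.Adj] {k : ℕ} (hk : 1 ≤ k) (hG : G.CliqueFree (k + 1)) :
    ∑ x, (G.degree x : ℝ) ^ 2 ≤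
      (1 - 1 / (k : ℝ)) * Fintype.card V * ∑ x, (G.degree x : ℝ) := by
  simpa [adjMatrix_mulVec_apply] using hG.sum_weight_mul_degree_sq_le hk (fun _ => 1) (fun _ => zero_le_one)

end SimpleGraph

/-! ### Counting blow-ups and extensions of partial maps. -/

theorem sum_pow_le_card_pow_mul_sum_pow {ι : Type*} [Fintype ι] (f : ι → ℝ) (hf : ∀ i, 0 ≤ f i)
    (p : ℕ) : Fintype.card ι * ((∑ i, f i) / Fintype.card ι) ^ p ≤ ∑ i, f i ^ p := by
  rcases isEmpty_or_nonempty ι with h | h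
  · simp
  have hc : (0 : ℝ) < Fintype.card ι := by exact_mod_cast Fintype.card_pos
  have := Real.pow_arith_mean_le_arith_mean_pow Finset.univ (fun _ => 1 / (Fintype.card ι : ℝ)) f
    (fun _ _ => by positivity) (by simp) (fun i _ => hf i) p
  simp only [← Finset.mul_sum] at this
  rw [one_div_mul_eq_div, one_div_mul_eq_div, le_div_iff₀ hc] at this
  linarith

/-- Counting homomorphic copies of the `T`-blow-up of a weighted complete `r`-uniform pattern:
repeated use of Jensen's inequality. -/
theorem card_pow_mul_density_pow_le_sum_blowup {V T : Type*} [Fintype V] [Fintype T] [Nonempty V]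
    [DecidableEq T] (r : ℕ) (f : (Fin r → V) → ℝ) (hf : ∀ ψ, 0 ≤ f ψ) :
    ((Fintype.card V : ℝ) ^ Fintype.card T) ^ r *
        ((∑ ψ, f ψ) / (Fintype.card V : ℝ) ^ r) ^ (Fintype.card T ^ r) ≤
      ∑ φ : Fin r → T → V, ∏ a : Fin r → T, f fun i => φ i (a i) := by
  have hn : (0 : ℝ) < Fintype.card V := by exact_mod_cast Fintype.card_pos
  set n : ℝ := (Fintype.card V : ℝ) with hndef
  set t := Fintype.card T with ht
  induction r with
  | zero =>
    simp
    refine le_of_eq (congrArg f (Subsingleton.elim _ _))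
  | succ r ih =>
    have hsplit : ∑ φ : Fin (r + 1) → T → V, ∏ a : Fin (r + 1) → T, f (fun i => φ i (a i)) =
        ∑ φ₀ : T → V, ∑ φ : Fin r → T → V, ∏ a : Fin r → T, ∏ b : T,
          f (Fin.cons (φ₀ b) fun i => φ i (a i)) := by
      rw [← (Fin.consEquiv fun _ => T → V).sum_comp, Fintype.sum_prod_type]
      refine Finset.sum_congr rfl fun φ₀ _ => Finset.sum_congr rfl fun φ _ => ?_
      rw [← (Fin.consEquiv fun _ => T).prod_comp, Fintype.prod_prod_type, Finset.prod_comm]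
      refine Finset.prod_congr rfl fun a _ => Finset.prod_congr rfl fun b _ => congrArg f ?_
      ext i
      refine Fin.cases ?_ (fun i => ?_) i <;> simp [Fin.consEquiv]
    -- Fixing the first part `φ₀` leaves an `r`-uniform pattern of total weight `X φ₀`. The
    -- induction hypothesis applies to it; Jensen over `φ₀` (exponent `t ^ r`) and then over `ψ`
    -- (exponent `t`) finishes.
    set X : (T → V) → ℝ := fun φ₀ => ∑ ψ : Fin r → V, ∏ b, f (Fin.cons (φ₀ b) ψ) with hX
    have hX0 : ∀ φ₀, 0 ≤ X φ₀ := fun φ₀ =>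
      Finset.sum_nonneg fun ψ _ => Finset.prod_nonneg fun b _ => hf _
    have h1 : ∀ φ₀, (n ^ t) ^ r * (X φ₀ / n ^ r) ^ (t ^ r) ≤
        ∑ φ : Fin r → T → V, ∏ a : Fin r → T, ∏ b : T,
          f (Fin.cons (φ₀ b) fun i => φ i (a i)) := fun φ₀ =>
      ih (fun ψ => ∏ b, f (Fin.cons (φ₀ b) ψ)) fun ψ => Finset.prod_nonneg fun b _ => hf _
    have h2 : n ^ t * ((∑ φ₀, X φ₀ / n ^ r) / n ^ t) ^ (t ^ r) ≤
        ∑ φ₀, (X φ₀ / n ^ r) ^ (t ^ r) := by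
      have := sum_pow_le_card_pow_mul_sum_pow (fun φ₀ => X φ₀ / n ^ r)
        (fun φ₀ => div_nonneg (hX0 _) (by positivity)) (t ^ r)
      simpa [Fintype.card_fun, ← hndef, ← ht] using this
    have h3 : ∑ φ₀, X φ₀ = ∑ ψ : Fin r → V, (∑ v, f (Fin.cons v ψ)) ^ t := by
      rw [hX, Finset.sum_comm]
      refine Finset.sum_congr rfl fun ψ _ => ?_
      rw [ht, ← Finset.card_univ, ← Finset.prod_const, Fintype.prod_sum]
    have h4 : n ^ r * ((∑ ψ, f ψ) / n ^ r) ^ t ≤ ∑ φ₀, X φ₀ := by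
      rw [h3]
      have := sum_pow_le_card_pow_mul_sum_pow (fun ψ : Fin r → V => ∑ v, f (Fin.cons v ψ))
        (fun ψ => Finset.sum_nonneg fun v _ => hf _) t
      rw [← (Fin.consEquiv fun _ => V).sum_comp, Fintype.sum_prod_type, Finset.sum_comm]
      simpa [Fintype.card_fun, ← hndef, Fin.consEquiv] using this
    have hs0 : 0 ≤ ∑ ψ, f ψ := Finset.sum_nonneg fun ψ _ => hf ψ
    have h5 : ((∑ ψ, f ψ) / n ^ (r + 1)) ^ t ≤ (∑ φ₀, X φ₀ / n ^ r) / n ^ t := by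
      rw [← Finset.sum_div, le_div_iff₀ (by positivity), le_div_iff₀ (by positivity)]
      refine le_trans (le_of_eq ?_) h4
      rw [pow_succ, ← div_div, div_pow _ n t]
      field_simp
    rw [hsplit]
    calc (n ^ t) ^ (r + 1) * ((∑ ψ, f ψ) / n ^ (r + 1)) ^ (t ^ (r + 1))
        = (n ^ t) ^ r * (n ^ t * (((∑ ψ, f ψ) / n ^ (r + 1)) ^ t) ^ (t ^ r)) := by
          rw [pow_succ t r, mul_comm (t ^ r) t, pow_mul _ t]; ring
      _ ≤ (n ^ t) ^ r * (n ^ t * ((∑ φ₀, X φ₀ / n ^ r) / n ^ t) ^ (t ^ r)) := by gcongr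
      _ ≤ (n ^ t) ^ r * ∑ φ₀, (X φ₀ / n ^ r) ^ (t ^ r) := by gcongr
      _ = ∑ φ₀, (n ^ t) ^ r * (X φ₀ / n ^ r) ^ (t ^ r) := Finset.mul_sum ..
      _ ≤ _ := Finset.sum_le_sum fun φ₀ _ => h1 φ₀

/-- Every `ψ : T → V` extends along `ι` in the same number of ways, one free choice for each point
outside the range. Hence distinct coordinates of a random map are independent and uniform. -/
theorem sum_comp_of_injective {S T V : Type*} [Fintype S] [Fintype T] [Fintype V] [DecidableEq S]
    [DecidableEq T] {ι : T → S} (hι : ι.Injective) (g : (T → V) → ℝ) :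
    ∑ φ : S → V, g (φ ∘ ι) =
      (Fintype.card V : ℝ) ^ (Fintype.card S - Fintype.card T) * ∑ ψ : T → V, g ψ := by
  classical
  let e : T ⊕ ↥(Set.range ι)ᶜ ≃ S :=
    ((Equiv.ofInjective ι hι).sumCongr (Equiv.refl _)).trans (Equiv.Set.sumCompl (Set.range ι))
  have he : ∀ t, e (Sum.inl t) = ι t := fun t => by simp [e]
  have hcard : Fintype.card ↥(Set.range ι)ᶜ = Fintype.card S - Fintype.card T := by
    rw [← Fintype.card_congr e, Fintype.card_sum, Nat.add_sub_cancel_left]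
  rw [← (e.arrowCongr (Equiv.refl V)).sum_comp, ← (Equiv.sumArrowEquivProdArrow T _ V).symm.sum_comp,
    Fintype.sum_prod_type]
  have : ∀ (ψ : T → V) (χ : ↥(Set.range ι)ᶜ → V),
      (e.arrowCongr (Equiv.refl V)) ((Equiv.sumArrowEquivProdArrow T _ V).symm (ψ, χ)) ∘ ι = ψ := by
    intro ψ χ
    ext t
    simp [← he, Equiv.arrowCongr, Equiv.sumArrowEquivProdArrow]
  simp only [this, Finset.sum_const, Finset.card_univ, Fintype.card_fun, hcard, nsmul_eq_mul,
    Nat.cast_pow, Finset.mul_sum]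

theorem sum_embedding_three_le {α : Type*} [Fintype α] [DecidableEq α] (g : α → α → α → ℝ)
    (hg : ∀ i j l, 0 ≤ g i j l) :
    ∑ f : Fin 3 ↪ α, g (f 0) (f 1) (f 2) ≤ ∑ i, ∑ j, ∑ l, g i j l := by
  simp only [← Fintype.sum_prod_type', ← Fintype.sum_prod_type (f := fun p : α × α × α => g p.1 p.2.1 p.2.2)]
  let e : (Fin 3 ↪ α) ↪ α × α × α :=
    ⟨fun f => (f 0, f 1, f 2), fun f f' h => by
      simp only [Prod.mk.injEq] at h
      ext i; fin_cases i
      exacts [h.1, h.2.1, h.2.2]⟩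
  calc ∑ f : Fin 3 ↪ α, g (f 0) (f 1) (f 2)
      = ∑ p ∈ Finset.univ.map e, g p.1 p.2.1 p.2.2 := by rw [Finset.sum_map]; rfl
    _ ≤ _ := Finset.sum_le_sum_of_subset_of_nonneg (Finset.subset_univ _) fun p _ _ => hg _ _ _

/-! ### From few cliques to a degree bound by sampling. -/

namespace SimpleGraph

variable {V : Type*} [Fintype V] (G : SimpleGraph V) [DecidableRel G.Adj]

theorem degree_eq_sum_ite (x : V) : (G.degree x : ℝ) = ∑ y, if G.Adj x y then (1 : ℝ) else 0 := by
  rw [Finset.sum_boole, ← card_neighborFinset_eq_degree, neighborFinset_eq_filter]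

theorem degree_sq_eq_sum_ite (x : V) : (G.degree x : ℝ) ^ 2 =
    ∑ y, ∑ z, if G.Adj x y ∧ G.Adj x z then (1 : ℝ) else 0 := by
  rw [degree_eq_sum_ite, sq, Finset.sum_mul_sum]
  simp only [ite_and, ite_mul, one_mul, zero_mul]

theorem sum_degree_nonneg : 0 ≤ ∑ x, (G.degree x : ℝ) :=
  Finset.sum_nonneg fun _ _ => Nat.cast_nonneg _

theorem sum_degree_sq_le_card_mul :
    ∑ x, (G.degree x : ℝ) ^ 2 ≤ Fintype.card V * ∑ x, (G.degree x : ℝ) := by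
  rw [Finset.mul_sum]
  refine Finset.sum_le_sum fun x _ => ?_
  rw [sq]
  exact mul_le_mul_of_nonneg_right (by exact_mod_cast (G.degree_lt_card_verts x).le)
    (Nat.cast_nonneg _)

/-- The number of homomorphisms from the complete graph on `Fin r` to `G`. -/
def cliqueHomCount (r : ℕ) : ℝ :=
  ∑ ψ : Fin r → V, if (∀ i j, i ≠ j → G.Adj (ψ i) (ψ j)) then 1 else 0

theorem sum_degree_sq_eq_sum_fin_three : ∑ x, (G.degree x : ℝ) ^ 2 =
    ∑ ψ : Fin 3 → V, if G.Adj (ψ 0) (ψ 1) ∧ G.Adj (ψ 0) (ψ 2) then (1 : ℝ) else 0 := by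
  simp only [degree_sq_eq_sum_ite]
  simp only [← (Fin.consEquiv fun _ => V).sum_comp, Fintype.sum_prod_type]
  simp [Fin.consEquiv, -Finset.sum_boole]
  rfl

theorem sum_degree_eq_sum_fin_two : ∑ x, (G.degree x : ℝ) =
    ∑ ψ : Fin 2 → V, if G.Adj (ψ 0) (ψ 1) then (1 : ℝ) else 0 := by
  simp only [degree_eq_sum_ite]
  simp only [← (Fin.consEquiv fun _ => V).sum_comp, Fintype.sum_prod_type]
  simp [Fin.consEquiv]

/-- A single clique already makes the error term at least `n ^ 3`, which exceeds `∑ d(v) ^ 2`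
trivially. The crude error is linear in the clique count, so it can be averaged. -/
theorem sum_degree_sq_le_add_cliqueHom [DecidableEq V] {k : ℕ} (hk : 1 ≤ k) :
    ∑ x, (G.degree x : ℝ) ^ 2 ≤ (1 - 1 / (k : ℝ)) * Fintype.card V * ∑ x, (G.degree x : ℝ) +
      (Fintype.card V : ℝ) ^ 3 *
        ∑ f : Fin (k + 1) ↪ V, if (∀ i j, i ≠ j → G.Adj (f i) (f j)) then (1 : ℝ) else 0 := by
  have hk0 : (1 : ℝ) ≤ k := by exact_mod_cast hk
  have hk1 : 0 ≤ 1 - 1 / (k : ℝ) := by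
    rw [sub_nonneg, div_le_one (by linarith)]; exact hk0
  have hE := G.sum_degree_nonneg
  have h0 : ∀ f : Fin (k + 1) ↪ V,
      0 ≤ if (∀ i j, i ≠ j → G.Adj (f i) (f j)) then (1 : ℝ) else 0 := fun f => by
    split_ifs <;> norm_num
  by_cases hG : G.CliqueFree (k + 1)
  · have := hG.sum_degree_sq_le hk
    have h1 : 0 ≤ ∑ f : Fin (k + 1) ↪ V,
        if (∀ i j, i ≠ j → G.Adj (f i) (f j)) then (1 : ℝ) else 0 :=
      Finset.sum_nonneg fun f _ => h0 f
    have := mul_nonneg (by positivity : (0 : ℝ) ≤ (Fintype.card V : ℝ) ^ 3) h1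
    linarith
  · rw [not_cliqueFree_iff_top_isContained] at hG
    obtain ⟨e⟩ := hG
    have h1 : (1 : ℝ) ≤ ∑ f : Fin (k + 1) ↪ V,
        if (∀ i j, i ≠ j → G.Adj (f i) (f j)) then (1 : ℝ) else 0 := by
      refine le_trans (le_of_eq ?_) (Finset.single_le_sum (fun f _ => h0 f)
        (Finset.mem_univ ⟨e, e.injective⟩))
      rw [if_pos]
      intro i j hij
      exact e.toHom.map_adj ((top_adj i j).2 hij)
    have h2 : ∑ x, (G.degree x : ℝ) ^ 2 ≤ (Fintype.card V : ℝ) ^ 3 := by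
      calc ∑ x, (G.degree x : ℝ) ^ 2 ≤ ∑ _x : V, (Fintype.card V : ℝ) ^ 2 :=
            Finset.sum_le_sum fun x _ => by
              have : (G.degree x : ℝ) ≤ Fintype.card V := by
                exact_mod_cast (G.degree_lt_card_verts x).le
              gcongr
        _ = _ := by rw [Finset.sum_const, nsmul_eq_mul, Finset.card_univ]; ring
    have h3 : (Fintype.card V : ℝ) ^ 3 * 1 ≤ (Fintype.card V : ℝ) ^ 3 * _ :=
      mul_le_mul_of_nonneg_left h1 (by positivity)
    have h4 : 0 ≤ (1 - 1 / (k : ℝ)) * Fintype.card V * ∑ x, (G.degree x : ℝ) := by positivity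
    linarith

/-- Averaging the bound for graphs without `(k + 1)`-cliques over random `s`-tuples of vertices. -/
theorem sampling_sum_degree_sq_le {k s : ℕ} (hk : 1 ≤ k) :
    (s.descFactorial 3 : ℝ) * ((Fintype.card V : ℝ) ^ (s - 3) * ∑ x, (G.degree x : ℝ) ^ 2) ≤
      (1 - 1 / (k : ℝ)) * s *
        (s ^ 2 * ((Fintype.card V : ℝ) ^ (s - 2) * ∑ x, (G.degree x : ℝ))) +
      s ^ 3 * (s ^ (k + 1) * ((Fintype.card V : ℝ) ^ (s - (k + 1)) * G.cliqueHomCount (k + 1))) := by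
  have hk0 : (1 : ℝ) ≤ k := by exact_mod_cast hk
  have hk1 : 0 ≤ 1 - 1 / (k : ℝ) := by
    rw [sub_nonneg, div_le_one (by linarith)]; exact hk0
  have hE := G.sum_degree_nonneg
  have hN : 0 ≤ G.cliqueHomCount (k + 1) :=
    Finset.sum_nonneg fun ψ _ => by split_ifs <;> norm_num
  -- Only triples of distinct sampled indices are kept; the discarded terms are nonnegative.
  have hlow : (s.descFactorial 3 : ℝ) * ((Fintype.card V : ℝ) ^ (s - 3) *
      ∑ x, (G.degree x : ℝ) ^ 2) ≤ ∑ φ : Fin s → V, ∑ i, ((G.comap φ).degree i : ℝ) ^ 2 := by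
    calc (s.descFactorial 3 : ℝ) * ((Fintype.card V : ℝ) ^ (s - 3) * ∑ x, (G.degree x : ℝ) ^ 2)
        = ∑ f : Fin 3 ↪ Fin s, ∑ φ : Fin s → V,
            if G.Adj (φ (f 0)) (φ (f 1)) ∧ G.Adj (φ (f 0)) (φ (f 2)) then (1 : ℝ) else 0 := by
          rw [sum_degree_sq_eq_sum_fin_three]
          have h := fun f : Fin 3 ↪ Fin s => sum_comp_of_injective f.injective
            fun ψ : Fin 3 → V => if G.Adj (ψ 0) (ψ 1) ∧ G.Adj (ψ 0) (ψ 2) then (1 : ℝ) else 0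
          simp only [Function.comp_apply] at h
          simp only [h]
          simp [Fintype.card_embedding_eq, -Finset.sum_boole]
      _ = ∑ φ : Fin s → V, ∑ f : Fin 3 ↪ Fin s,
            if G.Adj (φ (f 0)) (φ (f 1)) ∧ G.Adj (φ (f 0)) (φ (f 2)) then (1 : ℝ) else 0 :=
          Finset.sum_comm
      _ ≤ _ := Finset.sum_le_sum fun φ _ => by
          simp only [degree_sq_eq_sum_ite, comap_adj]
          exact sum_embedding_three_le (fun i j l =>
            if G.Adj (φ i) (φ j) ∧ G.Adj (φ i) (φ l) then (1 : ℝ) else 0)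
            fun i j l => by split_ifs <;> norm_num
  have hmid : ∑ φ : Fin s → V, ∑ i, ((G.comap φ).degree i : ℝ) ≤
      s ^ 2 * ((Fintype.card V : ℝ) ^ (s - 2) * ∑ x, (G.degree x : ℝ)) := by
    simp only [degree_eq_sum_ite (G.comap _), comap_adj]
    rw [Finset.sum_comm]
    have hij : ∀ i j : Fin s, ∑ φ : Fin s → V, (if G.Adj (φ i) (φ j) then (1 : ℝ) else 0) ≤
        (Fintype.card V : ℝ) ^ (s - 2) * ∑ x, (G.degree x : ℝ) := by
      intro i j
      by_cases h : i = j
      · subst h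
        simp only [SimpleGraph.irrefl, if_false, Finset.sum_const_zero]
        positivity
      · have hinj : Function.Injective ![i, j] := by
          intro a b hab
          fin_cases a <;> fin_cases b <;> simp_all [eq_comm]
        have := sum_comp_of_injective hinj
          fun ψ : Fin 2 → V => if G.Adj (ψ 0) (ψ 1) then (1 : ℝ) else 0
        rw [sum_degree_eq_sum_fin_two]
        simpa using this.le
    calc ∑ i, ∑ φ : Fin s → V, ∑ j, (if G.Adj (φ i) (φ j) then (1 : ℝ) else 0)
        = ∑ i, ∑ j, ∑ φ : Fin s → V, (if G.Adj (φ i) (φ j) then (1 : ℝ) else 0) :=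
          Finset.sum_congr rfl fun i _ => Finset.sum_comm
      _ ≤ ∑ _i : Fin s, ∑ _j : Fin s, (Fintype.card V : ℝ) ^ (s - 2) * ∑ x, (G.degree x : ℝ) :=
          Finset.sum_le_sum fun i _ => Finset.sum_le_sum fun j _ => hij i j
      _ = _ := by simp; ring
  have hcl : ∑ φ : Fin s → V, ∑ f : Fin (k + 1) ↪ Fin s,
      (if (∀ i j, i ≠ j → (G.comap φ).Adj (f i) (f j)) then (1 : ℝ) else 0) ≤
      s ^ (k + 1) * ((Fintype.card V : ℝ) ^ (s - (k + 1)) * G.cliqueHomCount (k + 1)) := by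
    rw [Finset.sum_comm]
    simp only [comap_adj]
    have h := fun f : Fin (k + 1) ↪ Fin s => sum_comp_of_injective f.injective
      fun ψ : Fin (k + 1) → V => if (∀ i j, i ≠ j → G.Adj (ψ i) (ψ j)) then (1 : ℝ) else 0
    simp only [Function.comp_apply] at h
    simp only [h]
    rw [Finset.sum_const, nsmul_eq_mul, Finset.card_univ, Fintype.card_embedding_eq,
      Fintype.card_fin, Fintype.card_fin]
    refine mul_le_mul_of_nonneg_right ?_ (mul_nonneg (by positivity) hN)
    exact_mod_cast Nat.descFactorial_le_pow s (k + 1)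
  have hsum : ∑ φ : Fin s → V, ∑ i, ((G.comap φ).degree i : ℝ) ^ 2 ≤
      (1 - 1 / (k : ℝ)) * s * ∑ φ : Fin s → V, ∑ i, ((G.comap φ).degree i : ℝ) +
      s ^ 3 * ∑ φ : Fin s → V, ∑ f : Fin (k + 1) ↪ Fin s,
        (if (∀ i j, i ≠ j → (G.comap φ).Adj (f i) (f j)) then (1 : ℝ) else 0) := by
    rw [Finset.mul_sum, Finset.mul_sum, ← Finset.sum_add_distrib]
    refine Finset.sum_le_sum fun φ _ => ?_
    simpa using (G.comap φ).sum_degree_sq_le_add_cliqueHom hk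
  refine hlow.trans (hsum.trans (add_le_add ?_ ?_))
  · exact mul_le_mul_of_nonneg_left hmid (by positivity)
  · exact mul_le_mul_of_nonneg_left hcl (by positivity)

theorem sum_degree_sq_le_of_cliqueHomCount_le {k s : ℕ} (hk : 1 ≤ k) (hs : 3 ≤ s) (hks : k + 1 ≤ s)
    {η : ℝ} (hN : G.cliqueHomCount (k + 1) ≤ η * (Fintype.card V : ℝ) ^ (k + 1)) :
    ∑ x, (G.degree x : ℝ) ^ 2 ≤
      (1 - 1 / (k : ℝ) + 3 / s) * Fintype.card V * ∑ x, (G.degree x : ℝ) +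
        s ^ (k + 1) * η * (Fintype.card V : ℝ) ^ 3 := by
  rcases isEmpty_or_nonempty V with h | h
  · simp
  have hn : (0 : ℝ) < Fintype.card V := by exact_mod_cast Fintype.card_pos
  have hsam := G.sampling_sum_degree_sq_le (s := s) hk
  have htriv := G.sum_degree_sq_le_card_mul
  set n : ℝ := (Fintype.card V : ℝ)
  set P := ∑ x, (G.degree x : ℝ) ^ 2
  set E := ∑ x, (G.degree x : ℝ)
  have hs0 : (0 : ℝ) < s := by exact_mod_cast (by omega : 0 < s)
  have hdesc : (s.descFactorial 3 : ℝ) = s * (s - 1) * (s - 2) := by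
    obtain ⟨m, rfl⟩ := Nat.exists_eq_add_of_le' hs
    simp [Nat.descFactorial]
    ring
  have e2 : n ^ (s - 2) = n ^ (s - 3) * n := by
    rw [← pow_succ]; congr 1; omega
  have e3 : n ^ (s - (k + 1)) * n ^ (k + 1) = n ^ (s - 3) * n ^ 3 := by
    rw [← pow_add, ← pow_add]; congr 1; omega
  have h1 : n ^ (s - (k + 1)) * G.cliqueHomCount (k + 1) ≤ n ^ (s - 3) * (η * n ^ 3) :=
    calc _ ≤ n ^ (s - (k + 1)) * (η * n ^ (k + 1)) := mul_le_mul_of_nonneg_left hN (by positivity)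
      _ = _ := by linear_combination η * e3
  have h2 : (s : ℝ) ^ 3 * (s ^ (k + 1) * (n ^ (s - (k + 1)) * G.cliqueHomCount (k + 1))) ≤
      s ^ 3 * (s ^ (k + 1) * (n ^ (s - 3) * (η * n ^ 3))) := by gcongr
  have hpos : 0 < n ^ (s - 3) := by positivity
  have h3 : n ^ (s - 3) * ((s * (s - 1) * (s - 2)) * P) ≤ n ^ (s - 3) *
      (s ^ 3 * ((1 - 1 / (k : ℝ)) * n * E + s ^ (k + 1) * η * n ^ 3)) := by
    rw [hdesc, e2] at hsam
    refine le_of_eq_of_le ?_ ((hsam.trans (add_le_add_right h2 _)).trans_eq ?_) <;> ring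
  have h4 := le_of_mul_le_mul_left h3 hpos
  have hP : 0 ≤ P := Finset.sum_nonneg fun _ _ => sq_nonneg _
  have hs3 : (3 : ℝ) ≤ s := by exact_mod_cast hs
  -- Passing from `s (s - 1) (s - 2)` to `s ^ 3` costs at most `3 s ^ 2 P`, paid by the trivial `P ≤
  -- n E`; this is the source of `3 / s`.
  have h5 : (s : ℝ) ^ 3 * P ≤ s ^ 3 * ((1 - 1 / (k : ℝ) + 3 / s) * n * E +
      s ^ (k + 1) * η * n ^ 3) := by
    have h6 : (s : ℝ) ^ 3 * ((1 - 1 / (k : ℝ) + 3 / s) * n * E + s ^ (k + 1) * η * n ^ 3) =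
      s ^ 3 * ((1 - 1 / (k : ℝ)) * n * E + s ^ (k + 1) * η * n ^ 3) + 3 * s ^ 2 * (n * E) := by
      field_simp
      ring
    rw [h6]
    have h7 : 3 * (s : ℝ) ^ 2 * P ≤ 3 * s ^ 2 * (n * E) := by gcongr
    nlinarith [mul_nonneg hs0.le hP]
  exact le_of_mul_le_mul_left h5 (by positivity)

end SimpleGraph
-- Sparse graphs, and the scarcity of cliques in `F`-free graphs.
namespace SimpleGraph

/-- The bound `2 ∑ d(v) ^ 2 ≤ n E + E ^ (3 / 2)` with `E = ∑ d(v)`, good for sparse graphs. -/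
theorem two_mul_sum_degree_sq_le {V : Type*} [Fintype V] [DecidableEq V] (G : SimpleGraph V)
    [DecidableRel G.Adj] :
    2 * ∑ x, (G.degree x : ℝ) ^ 2 ≤ Fintype.card V * ∑ x, (G.degree x : ℝ) +
      (∑ x, (G.degree x : ℝ)) * √(∑ x, (G.degree x : ℝ)) := by
  set A : V → V → ℝ := fun x y => if G.Adj x y then 1 else 0 with hA
  have hA01 : ∀ x y, A x y = 0 ∨ A x y = 1 := fun x y => by
    by_cases h : G.Adj x y <;> simp [hA, h]
  have hA0 : ∀ x y, 0 ≤ A x y := fun x y => by rcases hA01 x y with h | h <;> simp [h]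
  have hA1 : ∀ x y, A x y ≤ 1 := fun x y => by rcases hA01 x y with h | h <;> simp [h]
  have hAs : ∀ x y, A x y = A y x := fun x y => by simp [hA, G.adj_comm]
  have hd : ∀ x, (G.degree x : ℝ) = ∑ y, A x y := G.degree_eq_sum_ite
  set E := ∑ x, (G.degree x : ℝ) with hE
  have hE' : E = ∑ x, ∑ y, A x y := Finset.sum_congr rfl fun x _ => hd x
  have hE0 : 0 ≤ E := G.sum_degree_nonneg
  set c : V → V → ℝ := fun x y => ∑ z, A x z * A y z with hc
  have hP : ∑ x, (G.degree x : ℝ) ^ 2 = ∑ x, ∑ y, A x y * ∑ z, A x z :=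
    Finset.sum_congr rfl fun x _ => by rw [← Finset.sum_mul, hd, sq]
  have hP' : ∑ x, (G.degree x : ℝ) ^ 2 = ∑ x, ∑ y, A x y * ∑ z, A y z := by
    rw [hP, Finset.sum_comm]
    exact Finset.sum_congr rfl fun x _ => Finset.sum_congr rfl fun y _ => by rw [hAs]
  -- For an edge `xy`, inclusion–exclusion gives `d(x) + d(y) ≤ n + c x y`, where `c` is the
  -- codegree; sum over ordered edges.
  have h1 : 2 * ∑ x, (G.degree x : ℝ) ^ 2 ≤
      Fintype.card V * E + ∑ x, ∑ y, A x y * c x y := by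
    rw [two_mul]
    nth_rewrite 1 [hP]
    rw [hP', hE', Finset.mul_sum]
    simp only [Finset.mul_sum, ← Finset.sum_add_distrib]
    refine Finset.sum_le_sum fun x _ => ?_
    refine Finset.sum_le_sum fun y _ => ?_
    have : (Fintype.card V : ℝ) * A x y = ∑ _z : V, A x y := by simp
    rw [this, hc, Finset.mul_sum, ← Finset.sum_add_distrib]
    refine Finset.sum_le_sum fun z _ => ?_
    have : 0 ≤ A x y * ((1 - A x z) * (1 - A y z)) :=
      mul_nonneg (hA0 _ _) (mul_nonneg (sub_nonneg.2 (hA1 _ _)) (sub_nonneg.2 (hA1 _ _)))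
    nlinarith
  -- The left side counts closed 4-walks; forgetting two opposite edges leaves pairs of edges.
  -- Cauchy–Schwarz then bounds the triangle term by `E ^ (3 / 2)`.
  have hc2 : ∑ x, ∑ y, c x y ^ 2 ≤ E ^ 2 := by
    have e1 : ∀ x y, c x y ^ 2 = ∑ z, ∑ w, (A x z * A y z) * (A x w * A y w) := fun x y => by
      rw [sq, hc, Finset.sum_mul_sum]
    have e2 : E ^ 2 = ∑ x, ∑ y, ∑ z, ∑ w, A x z * A y w := by
      rw [hE', sq, Finset.sum_mul_sum]
      exact Finset.sum_congr rfl fun x _ => Finset.sum_congr rfl fun y _ => Finset.sum_mul_sum ..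
    rw [e2]
    simp only [e1]
    refine Finset.sum_le_sum fun x _ => Finset.sum_le_sum fun y _ => Finset.sum_le_sum fun z _ =>
      Finset.sum_le_sum fun w _ => ?_
    have : A y z * A x w ≤ 1 := mul_le_one₀ (hA1 _ _) (hA0 _ _) (hA1 _ _)
    nlinarith [mul_nonneg (hA0 x z) (hA0 y w)]
  have hT : (∑ x, ∑ y, A x y * c x y) ^ 2 ≤ E * E ^ 2 := by
    simp only [← Fintype.sum_prod_type']
    refine (Finset.sum_mul_sq_le_sq_mul_sq _ _ _).trans ?_
    simp only [Fintype.sum_prod_type]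
    refine mul_le_mul ?_ hc2 (Finset.sum_nonneg fun _ _ => Finset.sum_nonneg fun _ _ => sq_nonneg _)
      hE0
    rw [hE']
    refine Finset.sum_le_sum fun x _ => Finset.sum_le_sum fun y _ => ?_
    rcases hA01 x y with h | h <;> simp [h]
  have h2 : ∑ x, ∑ y, A x y * c x y ≤ E * √E := by
    refine (Real.le_sqrt_of_sq_le hT).trans_eq ?_
    rw [mul_comm, Real.sqrt_mul (by positivity), Real.sqrt_sq hE0]
  linarith

/-- If `F` is `r`-colourable then `F`-free graphs have `o(n ^ r)` cliques on `r` vertices. -/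
theorem Colorable.exists_forall_cliqueHomCount_le {W : Type*} [Finite W] {F : SimpleGraph W} {r : ℕ}
    (hF : F.Colorable r) {η : ℝ} (hη : 0 < η) :
    ∃ n₀ : ℕ, ∀ (V : Type*) [Fintype V] [DecidableEq V] (G : SimpleGraph V) [DecidableRel G.Adj],
      n₀ ≤ Fintype.card V → F.Free G →
        G.cliqueHomCount r ≤ η * (Fintype.card V : ℝ) ^ r := by
  have := Fintype.ofFinite W
  have := Classical.decEq W
  obtain ⟨C⟩ := hF
  set M : ℝ := (Fintype.card (Fin r × W) : ℝ) ^ 2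
  obtain ⟨n₀, hn₀⟩ := exists_nat_gt (M / η ^ (Fintype.card W ^ r))
  refine ⟨n₀ + 1, fun V _ _ G _ hV hfree => ?_⟩
  have hVpos : 0 < Fintype.card V := by omega
  have : Nonempty V := Fintype.card_pos_iff.1 hVpos
  have hn : (0 : ℝ) < Fintype.card V := by exact_mod_cast hVpos
  by_contra! hN
  set f : (Fin r → V) → ℝ := fun ψ => if (∀ i j, i ≠ j → G.Adj (ψ i) (ψ j)) then 1 else 0
  have hf : ∀ ψ, 0 ≤ f ψ := fun ψ => by simp only [f]; split_ifs <;> norm_num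
  have hf1 : ∀ ψ, f ψ ≤ 1 := fun ψ => by simp only [f]; split_ifs <;> norm_num
  have hlow := card_pow_mul_density_pow_le_sum_blowup (T := W) r f hf
  have hdens : η ≤ (∑ ψ, f ψ) / (Fintype.card V : ℝ) ^ r := by
    rw [le_div_iff₀ (by positivity)]; exact hN.le
  -- Only non-injective maps can be homomorphisms of the blow-up: an injective one would embed `F`
  -- through `w ↦ φ (C w, w)`, with `C` a proper colouring. So the count is at most the number of
  -- collisions.
  have hpt : ∀ φ : Fin r × W → V, (∏ a : Fin r → W, f fun i => φ (i, a i)) ≤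
      ∑ p : Fin r × W, ∑ q : Fin r × W, if p ≠ q ∧ φ p = φ q then 1 else 0 := by
    intro φ
    have hnn : ∀ p q : Fin r × W, (0 : ℝ) ≤ if p ≠ q ∧ φ p = φ q then 1 else 0 := fun p q => by
      split_ifs <;> norm_num
    by_cases hinj : Function.Injective φ
    · have : ∃ a : Fin r → W, f (fun i => φ (i, a i)) = 0 := by
        by_contra! hne
        refine hfree ⟨⟨⟨fun w => φ (C w, w), ?_⟩, ?_⟩⟩
        · intro w w' hww
          have hC : C w ≠ C w' := C.valid hww
          -- This transversal contains both `(C w, w)` and `(C w', w')`, so its nonvanishing weight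
          -- gives the required adjacency.
          have h := hne fun i => if i = C w then w else w'
          simp only [f, ne_eq, ite_eq_right_iff, one_ne_zero, imp_false, not_not] at h
          simpa [hC.symm] using h (C w) (C w') hC
        · intro w w' h
          exact congrArg Prod.snd (hinj h)
      obtain ⟨a, ha⟩ := this
      rw [Finset.prod_eq_zero (Finset.mem_univ a) ha]
      exact Finset.sum_nonneg fun p _ => Finset.sum_nonneg fun q _ => hnn p q
    · simp only [Function.Injective, not_forall] at hinj
      obtain ⟨p, q, hpq, hne⟩ := hinj
      calc _ ≤ (1 : ℝ) := Finset.prod_le_one (fun a _ => hf _) fun a _ => hf1 _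
        _ = if p ≠ q ∧ φ p = φ q then 1 else 0 := (if_pos ⟨hne, hpq⟩).symm
        _ ≤ ∑ q : Fin r × W, if p ≠ q ∧ φ p = φ q then 1 else 0 :=
          Finset.single_le_sum (f := fun q => if p ≠ q ∧ φ p = φ q then (1 : ℝ) else 0)
            (fun q _ => hnn p q) (Finset.mem_univ q)
        _ ≤ _ := Finset.single_le_sum
          (f := fun p => ∑ q : Fin r × W, if p ≠ q ∧ φ p = φ q then (1 : ℝ) else 0)
            (fun p _ => Finset.sum_nonneg fun q _ => hnn p q) (Finset.mem_univ p)
  set n : ℝ := (Fintype.card V : ℝ)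
  set t := Fintype.card W with ht
  -- A prescribed collision loses one factor `n`, whereas clique density `η` would force at least `η
  -- ^ (t ^ r) * n ^ (r * t)` homomorphisms.
  have hcoll : ∀ p q : Fin r × W,
      n * ∑ φ : Fin r × W → V, (if p ≠ q ∧ φ p = φ q then (1 : ℝ) else 0) ≤ (n ^ t) ^ r := by
    intro p q
    by_cases hpq : p = q
    · simp only [hpq, ne_eq, not_true_eq_false, false_and, if_false, Finset.sum_const_zero, mul_zero]
      positivity
    have hinj : Function.Injective ![p, q] := by
      intro a b hab
      fin_cases a <;> fin_cases b <;> simp_all [eq_comm]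
    have hcard : 2 ≤ r * t := by
      simpa [ht] using Fintype.card_le_of_injective _ hinj
    have h2 : ∑ ψ : Fin 2 → V, (if ψ 0 = ψ 1 then (1 : ℝ) else 0) = n := by
      simp only [← (Fin.consEquiv fun _ => V).sum_comp, Fintype.sum_prod_type]
      simp [Fin.consEquiv, n]
    have h : ∑ φ : Fin r × W → V, (if φ p = φ q then (1 : ℝ) else 0) = n ^ (r * t - 2) * n :=
      (sum_comp_of_injective hinj fun ψ => if ψ 0 = ψ 1 then (1 : ℝ) else 0).trans (by
        rw [h2, Fintype.card_prod, Fintype.card_fin, Fintype.card_fin])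
    simp only [ne_eq, hpq, not_false_eq_true, true_and]
    refine le_of_eq ?_
    rw [h, ← pow_mul, mul_comm t r]
    obtain ⟨m, hm⟩ := Nat.exists_eq_add_of_le' hcard
    rw [hm, Nat.add_sub_cancel]
    ring
  have hup : n * ∑ φ : Fin r → W → V, ∏ a : Fin r → W, f (fun i => φ i (a i)) ≤
      M * (n ^ t) ^ r := by
    rw [← (Equiv.curry (Fin r) W V).sum_comp]
    calc n * ∑ φ : Fin r × W → V, ∏ a : Fin r → W, f (fun i => φ (i, a i))
        ≤ n * ∑ φ : Fin r × W → V, ∑ p : Fin r × W, ∑ q : Fin r × W,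
            if p ≠ q ∧ φ p = φ q then (1 : ℝ) else 0 := by
          gcongr with φ; exact hpt φ
      _ = ∑ p : Fin r × W, ∑ q : Fin r × W, n * ∑ φ : Fin r × W → V,
            if p ≠ q ∧ φ p = φ q then (1 : ℝ) else 0 := by
          rw [Finset.sum_comm, Finset.mul_sum]
          refine Finset.sum_congr rfl fun p _ => ?_
          rw [Finset.sum_comm, Finset.mul_sum]
      _ ≤ ∑ _p : Fin r × W, ∑ _q : Fin r × W, (n ^ t) ^ r :=
          Finset.sum_le_sum fun p _ => Finset.sum_le_sum fun q _ => hcoll p q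
      _ = _ := by
          simp only [Finset.sum_const, Finset.card_univ, nsmul_eq_mul, M]
          ring
  have h3 : (n ^ t) ^ r * (n * η ^ (t ^ r)) ≤ (n ^ t) ^ r * M :=
    calc _ = n * ((n ^ t) ^ r * η ^ (t ^ r)) := by ring
      _ ≤ n * ((n ^ t) ^ r * ((∑ ψ, f ψ) / n ^ r) ^ (t ^ r)) := by gcongr
      _ ≤ n * _ := mul_le_mul_of_nonneg_left hlow hn.le
      _ ≤ _ := hup.trans_eq (mul_comm _ _)
  have h4 := le_of_mul_le_mul_left h3 (by positivity)
  rw [div_lt_iff₀ (by positivity)] at hn₀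
  have h5 : (n₀ : ℝ) ≤ n := Nat.cast_le.2 (by omega)
  have h6 : (n₀ : ℝ) * η ^ (t ^ r) ≤ n * η ^ (t ^ r) := by gcongr
  linarith

end SimpleGraph

/-! ### From a threshold for each `ε` to one null sequence. -/

theorem exists_tendsto_zero_of_eventually {p : ℕ → ℝ → Prop}
    (hmono : ∀ n e e', e ≤ e' → p n e → p n e') {C : ℝ} (hC : 0 ≤ C) (hp : ∀ n, p n C)
    (hlim : ∀ e > 0, ∃ N, ∀ n ≥ N, p n e) :
    ∃ ε : ℕ → ℝ, Tendsto ε atTop (𝓝 0) ∧ ∀ n, p n (ε n) := by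
  set S : ℕ → Set ℝ := fun n => {e | 0 ≤ e ∧ p n e}
  have hne : ∀ n, (S n).Nonempty := fun n => ⟨C, hC, hp n⟩
  have hbdd : ∀ n, BddBelow (S n) := fun n => ⟨0, fun e he => he.1⟩
  -- The infimum of the admissible errors need not be admissible; the vanishing extra term and
  -- monotonicity repair this.
  refine ⟨fun n => sInf (S n) + 1 / ((n : ℝ) + 1), ?_, fun n => ?_⟩
  · have h1 : Tendsto (fun n => sInf (S n)) atTop (𝓝 0) := by
      rw [Metric.tendsto_atTop]
      intro e he
      obtain ⟨N, hN⟩ := hlim (e / 2) (by linarith)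
      refine ⟨N, fun n hn => ?_⟩
      have h0 : 0 ≤ sInf (S n) := le_csInf (hne n) fun e he => he.1
      have h2 : sInf (S n) ≤ e / 2 := csInf_le (hbdd n) ⟨by linarith, hN n hn⟩
      rw [Real.dist_eq, sub_zero, abs_of_nonneg h0]
      linarith
    simpa using h1.add tendsto_one_div_add_atTop_nhds_zero_nat
  · obtain ⟨e, he, hlt⟩ := exists_lt_of_csInf_lt (hne n)
      (lt_add_of_pos_right (sInf (S n)) (by positivity : 0 < 1 / ((n : ℝ) + 1)))
    exact hmono n e _ hlt.le he.2

namespace SimpleGraph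

theorem Colorable.exists_forall_sum_degree_sq_le {W : Type*} [Finite W] {F : SimpleGraph W} {k : ℕ}
    (hk : 2 ≤ k) (hF : F.Colorable (k + 1)) {ε : ℝ} (hε : 0 < ε) :
    ∃ n₀ : ℕ, ∀ (V : Type*) [Fintype V] [DecidableEq V] (G : SimpleGraph V) [DecidableRel G.Adj],
      n₀ ≤ Fintype.card V → F.Free G →
        ∑ x, (G.degree x : ℝ) ^ 2 ≤
          (1 - 1 / (k : ℝ) + ε) * Fintype.card V * ∑ x, (G.degree x : ℝ) := by
  obtain ⟨s₀, hs₀⟩ := exists_nat_gt (6 / ε)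
  set s := max s₀ (k + 1) with hs
  have hks : k + 1 ≤ s := le_max_right _ _
  have hs0 : (0 : ℝ) < s := by exact_mod_cast (by omega : 0 < s)
  have hs3 : 3 / (s : ℝ) ≤ ε / 2 := by
    have h1 : 6 / ε < s := hs₀.trans_le (by exact_mod_cast le_max_left _ _)
    rw [div_lt_iff₀ hε] at h1
    rw [div_le_iff₀ hs0]
    linarith
  -- Chosen so that the sampling error is `ε ^ 3 n ^ 3 / 2`, which is at most `(ε / 2) n E` once `E
  -- ≥ (ε n) ^ 2`; below that threshold the sparse bound applies.
  set η := ε ^ 3 / (2 * (s : ℝ) ^ (k + 1)) with hη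
  obtain ⟨n₀, hn₀⟩ := hF.exists_forall_cliqueHomCount_le (η := η) (by positivity)
  refine ⟨n₀, fun V _ _ G _ hV hfree => ?_⟩
  have hdense := G.sum_degree_sq_le_of_cliqueHomCount_le (by omega) (by omega) hks
    (hn₀ V G hV hfree)
  have hsparse := G.two_mul_sum_degree_sq_le
  have hE0 := G.sum_degree_nonneg
  set n : ℝ := (Fintype.card V : ℝ)
  have hn : 0 ≤ n := Nat.cast_nonneg _
  set E := ∑ x, (G.degree x : ℝ)
  have hηs : (s : ℝ) ^ (k + 1) * η = ε ^ 3 / 2 := by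
    rw [hη]; field_simp
  have hnE : 0 ≤ n * E := mul_nonneg hn hE0
  have hk2 : 1 / (k : ℝ) ≤ 1 / 2 := one_div_le_one_div_of_le two_pos (by exact_mod_cast hk)
  rcases le_total E ((ε * n) ^ 2) with h | h
  · have h1 : √E ≤ ε * n := Real.sqrt_le_iff.2 ⟨by positivity, h⟩
    have h2 : E * √E ≤ E * (ε * n) := mul_le_mul_of_nonneg_left h1 hE0
    nlinarith [mul_nonneg hε.le hnE, mul_le_mul_of_nonneg_right hk2 hnE]
  · rw [hηs] at hdense
    have h1 : ε / 2 * n * (ε * n) ^ 2 ≤ ε / 2 * n * E :=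
      mul_le_mul_of_nonneg_left h (by positivity)
    have h2 := mul_le_mul_of_nonneg_right hs3 hnE
    nlinarith

/-! ### Tightness: Turán and complete bipartite graphs. -/

theorem free_of_colorable_of_lt_chromaticNumber {W V : Type*} {F : SimpleGraph W}
    {G : SimpleGraph V} {k : ℕ} (hG : G.Colorable k) (hF : (k : ℕ∞) < F.chromaticNumber) :
    F.Free G := fun ⟨f⟩ =>
  absurd (chromaticNumber_le_iff_colorable.2 (hG.of_hom f.toHom)) (not_le.2 hF)

theorem turanGraph_colorable {n k : ℕ} (hk : 0 < k) : (turanGraph n k).Colorable k :=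
  ⟨Coloring.mk (fun v => ⟨v % k, Nat.mod_lt _ hk⟩) fun h => by
    simpa [Fin.ext_iff] using turanGraph_adj.1 h⟩

/-- The degree is `n` minus the size of a residue class modulo `k`, and that size is within 1 of `n
/ k`. -/
theorem abs_degree_turanGraph_sub_le {n k : ℕ} (hk : 0 < k) (v : Fin n) :
    |((turanGraph n k).degree v : ℝ) - (1 - 1 / (k : ℝ)) * n| ≤ 1 := by
  have hk0 : (0 : ℝ) < k := by exact_mod_cast hk
  have hcount : ((Finset.univ.filter fun w : Fin n => v.1 % k = w % k).card : ℝ) +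
      (turanGraph n k).degree v = n := by
    rw [← card_neighborFinset_eq_degree, neighborFinset_eq_filter]
    have := Finset.card_filter_add_card_filter_not (s := (Finset.univ : Finset (Fin n)))
      (fun w : Fin n => v.1 % k = w % k)
    simp only [turanGraph_adj]
    rw [Finset.card_univ, Fintype.card_fin] at this
    exact_mod_cast this
  have hc : (Finset.univ.filter fun w : Fin n => v.1 % k = w % k).card =
      Nat.count (· ≡ v [MOD k]) n := by
    rw [Nat.count_eq_card_filter_range, Finset.card_filter, Finset.card_filter,
      Fin.sum_univ_eq_sum_range (fun w => if v.1 % k = w % k then 1 else 0) n]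
    exact Finset.sum_congr rfl fun w _ => if_congr eq_comm rfl rfl
  have hceil := Nat.count_modEq_card_eq_ceil n hk v
  set c := Nat.count (· ≡ v [MOD k]) n
  rw [hc] at hcount
  have hm : ((v.1 % k : ℕ) : ℝ) ≤ k := by exact_mod_cast (Nat.mod_lt _ hk).le
  have hm0 : (0 : ℝ) ≤ ((v.1 % k : ℕ) : ℝ) := Nat.cast_nonneg _
  have hlow : ((n : ℝ) - (v.1 % k : ℕ)) / k ≤ c := by
    have h : ((n : ℚ) - (v.1 % k : ℕ)) / k ≤ c := by
      simpa [← hceil] using Int.le_ceil (((n : ℚ) - (v.1 % k : ℕ)) / k)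
    simpa using (Rat.cast_le (K := ℝ)).2 h
  have hup : (c : ℝ) < ((n : ℝ) - (v.1 % k : ℕ)) / k + 1 := by
    have h : (c : ℚ) < ((n : ℚ) - (v.1 % k : ℕ)) / k + 1 := by
      simpa [← hceil] using Int.ceil_lt_add_one (((n : ℚ) - (v.1 % k : ℕ)) / k)
    simpa using (Rat.cast_lt (K := ℝ)).2 h
  have h1 : ((n : ℝ) - (v.1 % k : ℕ)) / k ≤ n / k := by gcongr; linarith
  have h2 : (n : ℝ) / k - 1 ≤ ((n : ℝ) - (v.1 % k : ℕ)) / k := by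
    rw [sub_div]
    have : ((v.1 % k : ℕ) : ℝ) / k ≤ 1 := (div_le_one hk0).2 hm
    linarith
  have h3 : (1 - 1 / (k : ℝ)) * n = n - n / k := by ring
  rw [abs_le, h3]
  constructor <;> linarith

theorem sum_degree_eq_two_mul_card_edgeFinset {V : Type*} [Fintype V] (G : SimpleGraph V)
    [DecidableRel G.Adj] : ∑ v, (G.degree v : ℝ) = 2 * (G.edgeFinset.card : ℝ) := by
  exact_mod_cast G.sum_degrees_eq_twice_card_edges

theorem exists_tendsto_sum_degree_sq_turanGraph {k : ℕ} (hk : 0 < k) :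
    ∃ δ : ℕ → ℝ, Tendsto δ atTop (𝓝 0) ∧ ∀ n : ℕ,
      ∑ v : Fin n, ((turanGraph n k).degree v : ℝ) ^ 2 =
        2 * (1 - 1 / (k : ℝ) + δ n) * ((turanGraph n k).edgeFinset.card : ℝ) * (n : ℝ) := by
  set c : ℝ := 1 - 1 / (k : ℝ)
  set E : ℕ → ℝ := fun n => ∑ v, ((turanGraph n k).degree v : ℝ)
  set R : ℕ → ℝ := fun n =>
    ∑ v, ((turanGraph n k).degree v : ℝ) * ((turanGraph n k).degree v - c * n)
  have hE0 : ∀ n, 0 ≤ E n := fun n => (turanGraph n k).sum_degree_nonneg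
  have hR : ∀ n, |R n| ≤ E n := fun n => by
    refine (Finset.abs_sum_le_sum_abs _ _).trans (Finset.sum_le_sum fun v _ => ?_)
    rw [abs_mul, Nat.abs_cast]
    exact mul_le_of_le_one_right (Nat.cast_nonneg _) (abs_degree_turanGraph_sub_le hk v)
  have hP : ∀ n : ℕ, ∑ v : Fin n, ((turanGraph n k).degree v : ℝ) ^ 2 = c * n * E n + R n :=
    fun n => by
      simp only [E, R]
      rw [Finset.mul_sum, ← Finset.sum_add_distrib]
      exact Finset.sum_congr rfl fun v _ => by ring
  -- Near-regularity gives `|R n| ≤ E n`, so this quotient is at most `1 / n` in absolute value. If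
  -- the denominator is zero, `R n` vanishes too and the identity survives.
  refine ⟨fun n => R n / (E n * n), ?_, fun n => ?_⟩
  · refine squeeze_zero_norm (fun n => ?_) tendsto_one_div_atTop_nhds_zero_nat
    rw [Real.norm_eq_abs, abs_div, abs_mul, abs_of_nonneg (hE0 n), Nat.abs_cast, ← div_div]
    exact div_le_div_of_nonneg_right (div_le_one_of_le₀ (hR n) (hE0 n)) (Nat.cast_nonneg n)
  · have hE2 : E n = 2 * ((turanGraph n k).edgeFinset.card : ℝ) :=
      (turanGraph n k).sum_degree_eq_two_mul_card_edgeFinset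
    have h1 : R n / (E n * n) * (E n * n) = R n := by
      rcases eq_or_ne (E n * n) 0 with h | h
      · have hEn : E n = 0 := by
          rcases mul_eq_zero.1 h with h | h
          · exact h
          · have : n = 0 := by exact_mod_cast h
            subst this
            simp [E]
        have := hR n
        rw [hEn] at this
        rw [abs_nonpos_iff.1 this, h, mul_zero]
      · exact div_mul_cancel₀ _ h
    rw [hP]
    linear_combination -h1 + (c * n + R n / (E n * n) * n) * hE2

theorem sum_degree_sq_completeBipartiteGraph {α β : Type*} [Fintype α] [Fintype β]
    [DecidableRel (completeBipartiteGraph α β).Adj] :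
    ∑ v, ((completeBipartiteGraph α β).degree v : ℝ) ^ 2 =
      ((completeBipartiteGraph α β).edgeFinset.card : ℝ) * Fintype.card (α ⊕ β) := by
  have hl : ∀ a : α, ((completeBipartiteGraph α β).degree (Sum.inl a) : ℝ) = Fintype.card β :=
    fun a => by simp [degree_eq_sum_ite, -Finset.sum_boole]
  have hr : ∀ b : β, ((completeBipartiteGraph α β).degree (Sum.inr b) : ℝ) = Fintype.card α :=
    fun b => by simp [degree_eq_sum_ite, -Finset.sum_boole]
  have h := (completeBipartiteGraph α β).sum_degree_eq_two_mul_card_edgeFinset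
  rw [Fintype.sum_sum_type] at h ⊢
  simp only [hl, hr, Finset.sum_const, Finset.card_univ, nsmul_eq_mul, Fintype.card_sum,
    Nat.cast_add] at h ⊢
  linear_combination ((Fintype.card α + Fintype.card β : ℝ) / 2) * h

end SimpleGraph

theorem theorem2p12 {W : Type*} [Finite W] (F : SimpleGraph W) (k : ℕ) (hk : 2 ≤ k)
    (hF : F.chromaticNumber = ((k + 1 : ℕ) : ℕ∞)) :
    -- the upper bound; the `o(1)` term is a null sequence depending on `F` (and `k`) only
    (∃ ε : ℕ → ℝ, Tendsto ε atTop (𝓝 0) ∧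
      ∀ (V : Type*) [Fintype V] [DecidableEq V] (G : SimpleGraph V) [DecidableRel G.Adj],
        F.Free G →
          ∑ v : V, (G.degree v : ℝ) ^ 2 ≤
            2 * (1 - 1 / (k : ℝ) + ε (Fintype.card V)) *
              (G.edgeFinset.card : ℝ) * (Fintype.card V : ℝ)) ∧
    -- tightness for `k = 2`: complete bipartite graphs
    (k = 2 → ∀ (a b : ℕ) [DecidableRel (completeBipartiteGraph (Fin a) (Fin b)).Adj],
      F.Free (completeBipartiteGraph (Fin a) (Fin b)) ∧
        ∑ v : Fin a ⊕ Fin b, ((completeBipartiteGraph (Fin a) (Fin b)).degree v : ℝ) ^ 2 =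
          2 * (1 - 1 / (k : ℝ)) *
            ((completeBipartiteGraph (Fin a) (Fin b)).edgeFinset.card : ℝ) *
            (Fintype.card (Fin a ⊕ Fin b) : ℝ)) ∧
    -- tightness for `k ≥ 3`: the `k`-partite Turán graphs
    (3 ≤ k →
      (∀ n : ℕ, F.Free (SimpleGraph.turanGraph n k)) ∧
      ∃ δ : ℕ → ℝ, Tendsto δ atTop (𝓝 0) ∧ ∀ n : ℕ,
        ∑ v : Fin n, ((SimpleGraph.turanGraph n k).degree v : ℝ) ^ 2 =
          2 * (1 - 1 / (k : ℝ) + δ n) *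
            ((SimpleGraph.turanGraph n k).edgeFinset.card : ℝ) * (n : ℝ)) := by
  have hcol : F.Colorable (k + 1) := SimpleGraph.chromaticNumber_le_iff_colorable.1 hF.le
  have hlt : (k : ℕ∞) < F.chromaticNumber := by
    rw [hF]
    exact_mod_cast Nat.lt_succ_self k
  refine ⟨?_, ?_, fun hk3 => ⟨fun n => SimpleGraph.free_of_colorable_of_lt_chromaticNumber
    (SimpleGraph.turanGraph_colorable (by omega)) hlt,
    SimpleGraph.exists_tendsto_sum_degree_sq_turanGraph (by omega)⟩⟩
  · obtain ⟨ε, hε, h⟩ := exists_tendsto_zero_of_eventually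
      (p := fun n e => ∀ (V : Type _) [Fintype V] [DecidableEq V] (G : SimpleGraph V)
        [DecidableRel G.Adj], Fintype.card V = n → F.Free G →
          ∑ v : V, (G.degree v : ℝ) ^ 2 ≤
            (1 - 1 / (k : ℝ) + e) * Fintype.card V * ∑ v, (G.degree v : ℝ))
      (fun n e e' hee h V _ _ G _ hV hfree => (h V G hV hfree).trans (by
        have := G.sum_degree_nonneg
        gcongr))
      zero_le_one
      (fun n V _ _ G _ _ _ => G.sum_degree_sq_le_card_mul.trans (by
        have := G.sum_degree_nonneg
        have hk1 : 1 / (k : ℝ) ≤ 1 := by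
          rw [div_le_one (by positivity)]
          exact_mod_cast (by omega : 1 ≤ k)
        rw [mul_assoc]
        exact le_mul_of_one_le_left (by positivity) (by linarith)))
      (fun e he => by
        obtain ⟨n₀, hn₀⟩ := hcol.exists_forall_sum_degree_sq_le hk he
        exact ⟨n₀, fun n hn V _ _ G _ hV hfree => hn₀ V G (hV ▸ hn) hfree⟩)
    refine ⟨ε, hε, fun V _ _ G _ hfree => (h _ V G rfl hfree).trans_eq ?_⟩
    rw [G.sum_degree_eq_two_mul_card_edgeFinset]
    ring
  · rintro rfl a b _
    refine ⟨SimpleGraph.free_of_colorable_of_lt_chromaticNumber ?_ hlt, ?_⟩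
    · simpa using (SimpleGraph.CompleteBipartiteGraph.bicoloring (Fin a) (Fin b)).colorable
    · rw [SimpleGraph.sum_degree_sq_completeBipartiteGraph]
      norm_num
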